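/- A lattice polytope in $\mathbb{R}^n$ is the convex hull of a finite nonempty subset of $\mathbb{Z}^n$; it need not be full-dimensional, and it is called a $d$-polytope if its affine span has dimension $d$. Two lattice polytopes $P\subset\mathbb{R}^n$ and $P'\subset\mathbb{R}^{n'}$ are equivalent if there is an affine isomorphism $\operatorname{aff}P\to\operatorname{aff}P'$ that maps $\mathbb{Z}^n\cap\operatorname{aff}P$ bijectively to $\mathbb{Z}^{n'}\cap\operatorname{aff}P'$ and maps $P$ onto $P'$. Let $V$ be the linear space parallel to $\operatorname{aff}P$, with lattice $M=V\cap\mathbb{Z}^n$ and dual lattice $M^*=\operatorname{Hom}(M,\mathbb{Z})\subset V^*$. The normal fan of $P$ consists of the cones $\sigma(P,F)=\{\varphi\in V^* : \varphi(y-x)\ge 0 \text{ for all } x\in F,\ y\in P\}$, where $F$ ranges over the nonempty faces of $P$. A cone $\sigma\subset V^*$ is unimodular if it is generated by a linearly independent set that is a $\mathbb{Z}$-basis of the lattice $M^*\cap\operatorname{span}\sigma$. The polytope $P$ is smooth if every cone in its normal fan is unimodular. **Theorem.** For all nonnegative integers $d$ and $N$, there are only finitely many equivalence classes of smooth $d$-polytopes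 $P$ such that exactly $N+1$ lattice points lie on the union of the edges (the one-dimensional faces) of $P$. -/

import Mathlib

/-- The integer lattice `ℤⁿ` inside `ℝⁿ`. -/
def IntLattice (n : ℕ) : Set (Fin n → ℝ) := {x | ∀ i, ∃ k : ℤ, x i = k}

/-- A (nonempty) lattice polytope in `ℝⁿ`: the convex hull of a finite nonempty set of
lattice points. It need not be full-dimensional. -/
structure LatticePolytope (n : ℕ) where
  /-- the underlying set of points -/
  carrier : Set (Fin n → ℝ)
  exists_finset : ∃ s : Finset (Fin n → ℝ),
    s.Nonempty ∧ ↑s ⊆ IntLattice n ∧ carrier = convexHull ℝ (s : Set (Fin n → ℝ))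

namespace LatticePolytope

variable {n m : ℕ}

/-- The linear space parallel to the affine span of `P`. -/
abbrev direction (P : LatticePolytope n) : Submodule ℝ (Fin n → ℝ) := vectorSpan ℝ P.carrier

/-- The dimension of `P`, that is, of its affine span. -/
noncomputable def dim (P : LatticePolytope n) : ℕ := Module.finrank ℝ P.direction

/-- The nonempty faces of `P`, including `P` itself: the sets of the points of `P` at which some
linear functional is maximal on `P`. -/
def IsFace (P : LatticePolytope n) (F : Set (Fin n → ℝ)) : Prop :=
  F.Nonempty ∧ IsExposed ℝ P.carrier F

/-- The edges of `P`: its one-dimensional faces. -/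
def IsEdge (P : LatticePolytope n) (F : Set (Fin n → ℝ)) : Prop :=
  P.IsFace F ∧ Module.finrank ℝ (vectorSpan ℝ F) = 1

/-- The set of lattice points that lie on some edge of `P`. -/
def edgeLatticePoints (P : LatticePolytope n) : Set (Fin n → ℝ) :=
  {x | x ∈ IntLattice n ∧ ∃ F, P.IsEdge F ∧ x ∈ F}

theorem carrier_nonempty (P : LatticePolytope n) : P.carrier.Nonempty := by
  obtain ⟨s, hs, -, h⟩ := P.exists_finset
  rw [h]
  exact hs.to_set.convexHull

instance (P : LatticePolytope n) : Nonempty (affineSpan ℝ P.carrier) :=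
  ((affineSpan_nonempty ℝ).2 P.carrier_nonempty).to_subtype

/-! ### Normal fan and smoothness

Let `V` be the direction of `P`, with the lattice `M = V ∩ ℤⁿ`. The normal fan of `P` lives in the
dual space of `V`, which carries the dual lattice `N = Hom(M, ℤ)`. -/

/-- The dual lattice `N = Hom(M, ℤ)`: the functionals on `V` that are integral on `M = V ∩ ℤⁿ`. -/
def dualLattice (P : LatticePolytope n) : Set (Module.Dual ℝ P.direction) :=
  {φ | ∀ v : P.direction, (v : Fin n → ℝ) ∈ IntLattice n → ∃ k : ℤ, φ v = k}

/-- The normal cone of `P` at the face `F`: the dual of the tangent cone, that is, the functionals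
`φ` with `φ (y - x) ≥ 0` for all `x ∈ F` and `y ∈ P`. -/
noncomputable def normalCone (P : LatticePolytope n) (F : Set (Fin n → ℝ)) :
    PointedCone ℝ (Module.Dual ℝ P.direction) :=
  PointedCone.dual (Module.Dual.eval ℝ P.direction)
    {v : P.direction | ∃ x ∈ F, ∃ y ∈ P.carrier, (v : Fin n → ℝ) = y - x}

/-- The normal fan of `P`: the collection of the normal cones at all nonempty faces of `P`. -/
def normalFan (P : LatticePolytope n) : Set (PointedCone ℝ (Module.Dual ℝ P.direction)) :=
  {σ | ∃ F, P.IsFace F ∧ σ = P.normalCone F}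

end LatticePolytope

/-- A cone `σ` in a real vector space `W` with lattice `L` is unimodular if it is generated by a
finite linearly independent set which is a basis of the lattice `L ∩ span σ`. (The members of such
a set are then exactly the primitive minimal generators of `σ`. For a cone `σ` of full dimension,
`L ∩ span σ` is `L`.) -/
def IsUnimodularCone {W : Type*} [AddCommGroup W] [Module ℝ W] (L : Set W)
    (σ : PointedCone ℝ W) : Prop :=
  ∃ B : Finset W,
    LinearIndependent ℝ (fun b : B => (b : W)) ∧
    (Submodule.span ℤ (B : Set W) : Set W) = L ∩ (Submodule.span ℝ (σ : Set W) : Set W) ∧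
    σ = PointedCone.hull ℝ (B : Set W)

namespace LatticePolytope

variable {n m : ℕ}

/-- `P` is smooth if every cone of its normal fan is unimodular with respect to the lattice `N`. -/
def IsSmooth (P : LatticePolytope n) : Prop :=
  ∀ σ ∈ P.normalFan, IsUnimodularCone P.dualLattice σ

/-- Integral equivalence: there is a bijective affine map `aff P → aff Q` that maps
`ℤⁿ ∩ aff P` onto `ℤᵐ ∩ aff Q` and `P` onto `Q`. -/
def IntegrallyEquivalent (P : LatticePolytope n) (Q : LatticePolytope m) : Prop :=
  ∃ e : affineSpan ℝ P.carrier ≃ᵃ[ℝ] affineSpan ℝ Q.carrier,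
    e '' {x : affineSpan ℝ P.carrier | (x : Fin n → ℝ) ∈ IntLattice n} =
      {y : affineSpan ℝ Q.carrier | (y : Fin m → ℝ) ∈ IntLattice m} ∧
    e '' {x : affineSpan ℝ P.carrier | (x : Fin n → ℝ) ∈ P.carrier} =
      {y : affineSpan ℝ Q.carrier | (y : Fin m → ℝ) ∈ Q.carrier}

/-- Integral equivalence as an equivalence relation on the lattice polytopes in all `ℝⁿ`. -/
instance integralSetoid : Setoid (Σ n, LatticePolytope n) where
  r P Q := IntegrallyEquivalent P.2 Q.2
  iseqv :=
    { refl := fun P => ⟨AffineEquiv.refl ℝ _, by simp, by simp⟩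
      symm := by
        rintro P Q ⟨e, h₁, h₂⟩
        refine ⟨e.symm, ?_, ?_⟩
        · rw [← h₁, ← Set.image_comp]; simp
        · rw [← h₂, ← Set.image_comp]; simp
      trans := by
        rintro P Q R ⟨e, h₁, h₂⟩ ⟨f, h₃, h₄⟩
        refine ⟨e.trans f, ?_, ?_⟩
        · rw [← h₃, ← h₁, ← Set.image_comp]; rfl
        · rw [← h₄, ← h₂, ← Set.image_comp]; rfl }

end LatticePolytope

/-!
At a vertex `p` of a smooth polytope, the primitive edge directions form a basis of the lattice, and
all of the polytope has nonnegative coordinates with respect to it. If `p` and `q` are joined by an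
edge, the basis at `q` consists of the reversed direction of that edge and of the vectors of the
basis at `p` sheared along the edge by integers `a`. These integers are bounded in terms of the
number of lattice points on the edges: going around the two-dimensional face that contains the
sheared direction, the inverse slope of the edges drops by at most one at each vertex. The simplex
method leads from any vertex to a given one in boundedly many edges, hence with respect to the basis
at one vertex all other vertices have bounded coordinates. In these coordinates the polytope is a
lattice polytope in a ball of bounded radius, and there are only finitely many of those.
-/

section CountAbove

variable {ι α : Type*} [Preorder α] (f : ι → α)

/-- The number of indices at which `f` is larger than at `p`; it bounds the length of a path that
starts at `p` and along which `f` increases. -/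
noncomputable def countAbove (p : ι) : ℕ := {r | f p < f r}.ncard

theorem countAbove_le_card [Fintype ι] (p : ι) : countAbove f p ≤ Fintype.card ι :=
  (Set.ncard_le_card _).trans_eq Nat.card_eq_fintype_card

theorem countAbove_lt_countAbove [Finite ι] {p q : ι} (h : f p < f q) :
    countAbove f q < countAbove f p :=
  Set.ncard_lt_ncard (ssubset_of_subset_not_subset (fun _ hr => h.trans hr)
    fun hsub => lt_irrefl _ (hsub h))

end CountAbove

/-- The vertices of a smooth polytope in a lattice `M`, and at each vertex the lattice basis formed
by the primitive directions of the edges at that vertex. -/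
structure SmoothConfig (ι κ M : Type*) [AddCommGroup M] where
  /-- the vertices -/
  vertex : ι → M
  /-- the primitive edge directions at a vertex -/
  edge : ι → Module.Basis κ ℤ M
  vertex_injective : Function.Injective vertex
  repr_nonneg : ∀ p q i, 0 ≤ (edge p).repr (vertex q - vertex p) i
  exists_vertex_on_ray : ∀ p i, ∃ q, ∃ l : ℤ, 0 < l ∧ vertex q = vertex p + l • edge p i

namespace SmoothConfig

variable {ι κ M : Type*} [AddCommGroup M] (C : SmoothConfig ι κ M)

/-- No edge has lattice length larger than `N`. -/
def EdgeLengthLE (N : ℕ) : Prop :=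
  ∀ ⦃p q i⦄ ⦃t : ℤ⦄, C.vertex q = C.vertex p + t • C.edge p i → t ≤ N

/-- The `i`-th edge at `p` is the `k`-th edge at `q`, traversed in the opposite direction. -/
def Adj (p : ι) (i : κ) (q : ι) (k : κ) : Prop :=
  (∃ l : ℤ, 0 < l ∧ C.vertex q = C.vertex p + l • C.edge p i) ∧ C.edge q k = -C.edge p i

/-- The vertices on the two-dimensional face spanned by the `i`-th and the `j`-th edge at `p`. -/
def face (p : ι) (i j : κ) : Set ι :=
  {r | C.vertex r - C.vertex p ∈ Submodule.span ℤ {C.edge p i, C.edge p j}}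

variable {C} {p q : ι} {i j k m : κ} {a l : ℤ} {N : ℕ}

theorem Adj.symm (h : C.Adj p i q k) : C.Adj q k p i := by
  obtain ⟨⟨l, hl, hq⟩, hk⟩ := h
  exact ⟨⟨l, hl, by rw [hk, hq]; module⟩, by rw [hk, neg_neg]⟩

theorem repr_edge_nonneg (hq : C.vertex q = C.vertex p + l • C.edge p i) (k : κ) (hj : j ≠ i) :
    0 ≤ (C.edge p).repr (C.edge q k) j := by
  obtain ⟨r, l', hl', hr⟩ := C.exists_vertex_on_ray q k
  have hrp : C.vertex r - C.vertex p = l • C.edge p i + l' • C.edge q k := by rw [hr, hq]; abel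
  have hcoord := C.repr_nonneg p r j
  simp only [hrp, map_add, map_smul, Finsupp.add_apply, Finsupp.smul_apply, smul_eq_mul,
    Module.Basis.repr_self, Finsupp.single_eq_of_ne hj, mul_zero, zero_add] at hcoord
  exact nonneg_of_mul_nonneg_right hcoord hl'

section Finite

variable [Finite κ]

theorem exists_edge_eq_smul (hl : 0 < l) (hq : C.vertex q = C.vertex p + l • C.edge p i) :
    ∃ k, ∃ s : ℤ, C.edge q k = s • C.edge p i ∧
      0 < (C.edge q).repr (C.vertex p - C.vertex q) k := by
  cases nonempty_fintype κ
  set c := (C.edge q).repr (C.vertex p - C.vertex q) with hc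
  have hsum : ∑ k, c k • C.edge q k = -l • C.edge p i := by
    rw [hc, (C.edge q).sum_repr, hq]; module
  obtain ⟨k, hk⟩ : ∃ k, 0 < c k := by
    by_contra! hno
    have hzero : ∀ k, c k = 0 := fun k => (hno k).antisymm (C.repr_nonneg q p k)
    simp only [hzero, zero_smul, Finset.sum_const_zero] at hsum
    have hl0 : l = 0 := by simpa using congrArg (fun v => (C.edge p).repr v i) hsum
    exact hl.ne' hl0
  refine ⟨k, (C.edge p).repr (C.edge q k) i, (C.edge p).ext_elem fun j => ?_, hk⟩
  rcases eq_or_ne j i with rfl | hj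
  · simp
  have hsum_j : ∑ k, c k * (C.edge p).repr (C.edge q k) j = 0 := by
    simpa [Finsupp.single_eq_of_ne hj] using congrArg (fun v => (C.edge p).repr v j) hsum
  have hk_j : c k * (C.edge p).repr (C.edge q k) j = 0 :=
    (Finset.sum_eq_zero_iff_of_nonneg fun k _ =>
      mul_nonneg (C.repr_nonneg q p k) (repr_edge_nonneg hq k hj)).1 hsum_j k (Finset.mem_univ k)
  simp [(mul_eq_zero.1 hk_j).resolve_left hk.ne', Finsupp.single_eq_of_ne hj]

theorem exists_edge_eq_neg (hl : 0 < l) (hq : C.vertex q = C.vertex p + l • C.edge p i) :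
    ∃ k, C.edge q k = -C.edge p i := by
  obtain ⟨k, s, hs, hk⟩ := exists_edge_eq_smul hl hq
  set r := (C.edge q).repr (C.edge p i) k with hr
  have hsr : s * r = 1 := by
    simpa [hr] using (congrArg (fun v => (C.edge q).repr v k) hs).symm
  have hr_neg : r < 0 := by
    have hpq : C.vertex p - C.vertex q = -l • C.edge p i := by rw [hq]; module
    rw [hpq, map_smul, Finsupp.smul_apply, smul_eq_mul] at hk
    nlinarith
  rcases Int.eq_one_or_neg_one_of_mul_eq_one hsr with hs1 | hs1
  · rw [hs1] at hsr
    omega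
  · exact ⟨k, by rw [hs, hs1, neg_one_smul]⟩

theorem exists_adj (C : SmoothConfig ι κ M) (p : ι) (i : κ) : ∃ q k, C.Adj p i q k := by
  obtain ⟨q, l, hl, hq⟩ := C.exists_vertex_on_ray p i
  obtain ⟨k, hk⟩ := exists_edge_eq_neg hl hq
  exact ⟨q, k, ⟨l, hl, hq⟩, hk⟩

/-- The smoothness condition makes the two edge bases at the ends of an edge agree modulo the
direction of this edge. -/
theorem Adj.exists_edge_eq (h : C.Adj p i q k) (hj : j ≠ i) :
    ∃ m ≠ k, ∃ a : ℤ, C.edge q m = C.edge p j + a • C.edge p i := by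
  cases nonempty_fintype κ
  obtain ⟨⟨_, -, hq⟩, hk⟩ := id h
  obtain ⟨⟨_, -, hp⟩, -⟩ := h.symm
  set c := (C.edge q).repr (C.edge p j) with hc
  have hsum : ∀ n, ∑ m, c m * (C.edge p).repr (C.edge q m) n = Finsupp.single j 1 n := by
    intro n
    have hrepr := congrArg (C.edge p).repr ((C.edge q).sum_repr (C.edge p j))
    simpa [-Module.Basis.sum_repr] using DFunLike.congr_fun hrepr n
  have hterm : ∀ n, n ≠ i → ∀ m, 0 ≤ c m * (C.edge p).repr (C.edge q m) n := by
    intro n hn m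
    rcases eq_or_ne m k with rfl | hm
    · simp [hk, Finsupp.single_eq_of_ne hn]
    · exact mul_nonneg (repr_edge_nonneg hp j hm) (repr_edge_nonneg hq m hn)
  obtain ⟨m, hm⟩ : ∃ m, 0 < c m * (C.edge p).repr (C.edge q m) j := by
    by_contra! hno
    have hj1 := hsum j
    rw [Finset.sum_eq_zero fun m _ => (hno m).antisymm (hterm j hj m)] at hj1
    simp at hj1
  have hmk : m ≠ k := by
    rintro rfl
    simp [hk, Finsupp.single_eq_of_ne hj] at hm
  have hle : c m * (C.edge p).repr (C.edge q m) j ≤ 1 := by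
    simpa [hsum j] using Finset.single_le_sum (fun m _ => hterm j hj m) (Finset.mem_univ m)
  have hmj : (C.edge p).repr (C.edge q m) j = 1 :=
    Int.eq_one_of_mul_eq_one_left (repr_edge_nonneg hq m hj)
      (le_antisymm hle hm)
  refine ⟨m, hmk, (C.edge p).repr (C.edge q m) i, (C.edge p).ext_elem fun n => ?_⟩
  rcases eq_or_ne n i with rfl | hn
  · simp [Finsupp.single_eq_of_ne hj.symm]
  rcases eq_or_ne n j with rfl | hnj
  · simp [hmj, Finsupp.single_eq_of_ne hn]
  · have hn0 : c m * (C.edge p).repr (C.edge q m) n = 0 :=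
      (Finset.sum_eq_zero_iff_of_nonneg fun m _ => hterm n hn m).1
        ((hsum n).trans (Finsupp.single_eq_of_ne hnj)) m (Finset.mem_univ m)
    simp [(mul_eq_zero.1 hn0).resolve_left (left_ne_zero_of_mul hm.ne'),
      Finsupp.single_eq_of_ne hn, Finsupp.single_eq_of_ne hnj]

end Finite

theorem Adj.face_eq (h : C.Adj p i q k) (hm : C.edge q m = C.edge p j + a • C.edge p i) :
    C.face q m k = C.face p i j := by
  obtain ⟨⟨l, -, hq⟩, hk⟩ := h
  have hspan : Submodule.span ℤ {C.edge q m, C.edge q k} =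
      Submodule.span ℤ {C.edge p i, C.edge p j} := by
    apply le_antisymm <;> rw [Submodule.span_le, Set.pair_subset_iff] <;>
      simp only [SetLike.mem_coe, Submodule.mem_span_pair]
    · exact ⟨⟨a, 1, by rw [hm]; module⟩, ⟨-1, 0, by rw [hk]; module⟩⟩
    · exact ⟨⟨0, -1, by rw [hk]; module⟩, ⟨1, a, by rw [hm, hk]; module⟩⟩
  have hqp : l • C.edge p i ∈ Submodule.span ℤ {C.edge p i, C.edge p j} :=
    Submodule.smul_mem _ _ (Submodule.subset_span (Set.mem_insert _ _))
  ext r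
  rw [face, face, Set.mem_ofPred_eq, Set.mem_ofPred_eq, hspan, hq, ← sub_sub,
    Submodule.sub_mem_iff_left _ hqp]

theorem face_comm (p : ι) (i j : κ) : C.face p i j = C.face p j i := by
  rw [face, face, Set.pair_comm]

theorem exists_nonneg_of_mem_face {r : ι} (hij : i ≠ j) (hr : r ∈ C.face p i j) :
    ∃ s t : ℤ, 0 ≤ s ∧ 0 ≤ t ∧ C.vertex r = C.vertex p + s • C.edge p i + t • C.edge p j := by
  obtain ⟨s, t, hst⟩ := Submodule.mem_span_pair.1 hr
  have hi := C.repr_nonneg p r i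
  have hj := C.repr_nonneg p r j
  rw [← hst] at hi hj
  refine ⟨s, t, ?_, ?_, by rw [add_assoc, hst]; abel⟩
  · simpa [Finsupp.single_eq_of_ne hij] using hi
  · simpa [Finsupp.single_eq_of_ne hij.symm] using hj

theorem EdgeLengthLE.neg_le_of_edge_eq (hC : C.EdgeLengthLE N) (h : C.Adj p i q k) (hj : j ≠ i)
    (hm : C.edge q m = C.edge p j + a • C.edge p i) : -N ≤ a := by
  obtain ⟨l, -, hq⟩ := h.1
  obtain ⟨r, l', hl', hr⟩ := C.exists_vertex_on_ray q m
  have hrp : C.vertex r - C.vertex p = (l + l' * a) • C.edge p i + l' • C.edge p j := by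
    rw [hr, hq, hm]; module
  have hcoord : 0 ≤ l + l' * a := by
    simpa [hrp, Finsupp.single_eq_of_ne hj.symm] using C.repr_nonneg p r i
  have hlN : l ≤ N := hC hq
  nlinarith

variable {X Y : Module.Dual ℤ M}

variable (C) in
/-- In the plane with coordinates `X` and `Y`, the vertex `z` is a highest vertex in `F`, and no
highest vertex in `F` is more than `N` to the left of `z`. -/
def IsTopVertex (N : ℕ) (X Y : Module.Dual ℤ M) (F : Set ι) (z : ι) : Prop :=
  z ∈ F ∧ ∀ r ∈ F, Y (C.vertex r) ≤ Y (C.vertex z) ∧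
    (Y (C.vertex r) = Y (C.vertex z) → X (C.vertex z) - N ≤ X (C.vertex r))

theorem EdgeLengthLE.isTopVertex (hC : C.EdgeLengthLE N) (hmk : m ≠ k)
    (hdet : X (C.edge q m) * Y (C.edge q k) - Y (C.edge q m) * X (C.edge q k) = 1)
    (hm : Y (C.edge q m) ≤ 0) (hk : Y (C.edge q k) < 0) :
    C.IsTopVertex N X Y (C.face q m k) q := by
  refine ⟨by simp [face], fun r hr => ?_⟩
  obtain ⟨s, t, hs, ht, hst⟩ := exists_nonneg_of_mem_face hmk hr
  have hsm : s * Y (C.edge q m) ≤ 0 := mul_nonpos_of_nonneg_of_nonpos hs hm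
  have htk : t * Y (C.edge q k) ≤ 0 := mul_nonpos_of_nonneg_of_nonpos ht hk.le
  have hYr : Y (C.vertex r) = Y (C.vertex q) + s * Y (C.edge q m) + t * Y (C.edge q k) := by
    simp [hst]
  refine ⟨by linarith, fun heq => ?_⟩
  obtain rfl : t = 0 :=
    (mul_eq_zero.1 (show t * Y (C.edge q k) = 0 by linarith)).resolve_right hk.ne
  have hXr : X (C.vertex r) = X (C.vertex q) + s * X (C.edge q m) := by simp [hst]
  rcases mul_eq_zero.1 (show s * Y (C.edge q m) = 0 by linarith) with rfl | hYm
  · simp [hXr]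
  · have hsN : s ≤ N := hC (q := r) (by simpa using hst)
    rw [hYm, zero_mul, sub_zero] at hdet
    have hXm : -1 ≤ X (C.edge q m) := by nlinarith
    nlinarith [hXm]

/-- If the primitive vectors `(x, y)` and `(x', y')` span the plane lattice, then their inverse
slopes differ by `1 / (y * y')`. -/
theorem neg_succ_mul_le {c x y x' y' : ℤ} (hy : 0 < y) (hy' : 0 < y')
    (hdet : x * y' - y * x' = 1) (hc : -c * y ≤ x) : -(c + 1) * y' ≤ x' := by
  have hcy : 0 ≤ (x + c * y) * y' := mul_nonneg (by linarith) hy'.le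
  have hmul : 0 ≤ y * (x' + (c + 1) * y') := by nlinarith [mul_pos hy hy']
  linarith [nonneg_of_mul_nonneg_right hmul hy]

variable (C) in
/-- The negated sum of the coordinates at `w`, a functional with its maximum on the polytope at
`w`. -/
noncomputable def height [Fintype κ] (w : ι) : Module.Dual ℤ M := -∑ i, (C.edge w).coord i

theorem exists_height_edge_pos [Fintype κ] {w : ι} (hp : p ≠ w) :
    ∃ i, 0 < C.height w (C.edge p i) := by
  by_contra! hno
  have hle : C.height w (C.vertex w - C.vertex p) ≤ 0 := by
    rw [← (C.edge p).sum_repr (C.vertex w - C.vertex p), map_sum]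
    refine Finset.sum_nonpos fun i _ => ?_
    rw [map_smul, smul_eq_mul]
    exact mul_nonpos_of_nonneg_of_nonpos (C.repr_nonneg p w i) (hno i)
  rw [← neg_sub, map_neg, height, LinearMap.neg_apply, neg_neg, LinearMap.sum_apply] at hle
  have hzero := (Finset.sum_eq_zero_iff_of_nonneg fun i _ => C.repr_nonneg w p i).1
    (hle.antisymm (Finset.sum_nonneg fun i _ => C.repr_nonneg w p i))
  refine hp (C.vertex_injective (sub_eq_zero.1 ((C.edge w).ext_elem fun i => ?_)))
  simpa using hzero i (Finset.mem_univ i)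

/-- Walk up the left side of a polygon: at each vertex the inverse slope drops by at most one. -/
theorem EdgeLengthLE.exists_isTopVertex [Finite ι] [Finite κ] (hC : C.EdgeLengthLE N) {p : ι}
    {i j : κ} {c : ℤ} (hij : i ≠ j)
    (hdet : X (C.edge p i) * Y (C.edge p j) - Y (C.edge p i) * X (C.edge p j) = 1)
    (hY : 0 < Y (C.edge p i)) (hc : -c * Y (C.edge p i) ≤ X (C.edge p i)) :
    ∃ z, C.IsTopVertex N X Y (C.face p i j) z ∧ Y (C.vertex p) < Y (C.vertex z) ∧
      -(c + countAbove (Y ∘ C.vertex) p) * (Y (C.vertex z) - Y (C.vertex p)) ≤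
        X (C.vertex z) - X (C.vertex p) := by
  obtain ⟨q, k, hadj⟩ := C.exists_adj p i
  obtain ⟨m, hmk, a, hm⟩ := hadj.exists_edge_eq hij.symm
  obtain ⟨⟨l, hl, hq⟩, hk⟩ := id hadj
  have hYq : Y (C.vertex q) = Y (C.vertex p) + l * Y (C.edge p i) := by simp [hq]
  have hXq : X (C.vertex q) = X (C.vertex p) + l * X (C.edge p i) := by simp [hq]
  have hlY : 0 < l * Y (C.edge p i) := mul_pos hl hY
  have hlX : -c * (l * Y (C.edge p i)) ≤ l * X (C.edge p i) := by nlinarith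
  have hlt : Y (C.vertex p) < Y (C.vertex q) := by linarith
  have hcount : (countAbove (Y ∘ C.vertex) q : ℤ) + 1 ≤ countAbove (Y ∘ C.vertex) p := by
    exact_mod_cast countAbove_lt_countAbove (Y ∘ C.vertex) hlt
  have hXm : X (C.edge q m) = X (C.edge p j) + a * X (C.edge p i) := by simp [hm]
  have hYm : Y (C.edge q m) = Y (C.edge p j) + a * Y (C.edge p i) := by simp [hm]
  have hdet' : X (C.edge q m) * Y (C.edge q k) - Y (C.edge q m) * X (C.edge q k) = 1 := by
    rw [hXm, hYm, hk, map_neg, map_neg]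
    linear_combination hdet
  rw [← hadj.face_eq hm]
  rcases lt_or_ge 0 (Y (C.edge q m)) with hpos | hnonpos
  · have hslope : -(c + 1) * Y (C.edge q m) ≤ X (C.edge q m) :=
      neg_succ_mul_le hY hpos (by rw [hXm, hYm]; linear_combination hdet) hc
    obtain ⟨z, hz, hqz, hle⟩ := hC.exists_isTopVertex hmk hdet' hpos hslope
    refine ⟨z, hz, hlt.trans hqz, ?_⟩
    rw [hYq, hXq] at hle
    rw [hYq] at hqz
    nlinarith
  · refine ⟨q, hC.isTopVertex hmk hdet' hnonpos (by rw [hk, map_neg]; linarith), hlt, ?_⟩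
    rw [hYq, hXq]
    nlinarith
termination_by countAbove (Y ∘ C.vertex) p
decreasing_by exact countAbove_lt_countAbove (Y ∘ C.vertex) hlt

/-- In the coordinates `X` and `Y`, one side of the polygon `C.face p j i` leaves `q` vertically and
the other side leaves `p` along `(-a, 1)`. Inverse slopes change by at most `Fintype.card ι` on the
way up, so the two sides could not meet at the top if `a` were too large. -/
theorem EdgeLengthLE.le_of_edge_eq [Fintype ι] [Finite κ] (hC : C.EdgeLengthLE N)
    (h : C.Adj p i q k) (hj : j ≠ i) (hmk : m ≠ k) (hm : C.edge q m = C.edge p j + a • C.edge p i) :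
    a ≤ 2 * Fintype.card ι + N := by
  obtain ⟨⟨l, hl, hq⟩, hk⟩ := id h
  set Y := (C.edge p).coord j
  set X := (C.edge p).coord i - a • (C.edge p).coord j
  have hXi : X (C.edge p i) = 1 := by simp [X, Finsupp.single_eq_of_ne hj]
  have hXj : X (C.edge p j) = -a := by simp [X, Finsupp.single_eq_of_ne hj.symm]
  have hYi : Y (C.edge p i) = 0 := by simp [Y, Finsupp.single_eq_of_ne hj]
  have hYj : Y (C.edge p j) = 1 := by simp [Y]
  have hXm : X (C.edge q m) = 0 := by simp [hm, hXi, hXj]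
  have hYm : Y (C.edge q m) = 1 := by simp [hm, hYi, hYj]
  have hXq : X (C.vertex q) = X (C.vertex p) + l := by simp [hq, hXi]
  have hYq : Y (C.vertex q) = Y (C.vertex p) := by simp [hq, hYi]
  obtain ⟨z, ⟨hzF, hz⟩, hqz, hz_right⟩ := hC.exists_isTopVertex (X := X) (Y := Y) (c := 0) hmk
    (by rw [hk, map_neg, map_neg, hXi, hYi, hXm, hYm]; norm_num) (by rw [hYm]; norm_num)
    (by rw [hXm]; norm_num)
  obtain ⟨w, ⟨hwF, hw⟩, -, hw_left⟩ := hC.exists_isTopVertex (p := p) (X := -X) (Y := Y) (c := -a)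
    hj (by simp [hXi, hYi, hYj]) (by rw [hYj]; norm_num) (by simp [hYj, hXj])
  rw [h.face_eq hm, face_comm] at hzF hz
  have hYwz : Y (C.vertex w) = Y (C.vertex z) := (hz w hwF).1.antisymm (hw z hzF).1
  have hXwz : X (C.vertex z) - N ≤ X (C.vertex w) := (hz w hwF).2 hYwz
  have hcount_q := countAbove_le_card (Y ∘ C.vertex) q
  have hcount_p := countAbove_le_card (Y ∘ C.vertex) p
  zify at hcount_q hcount_p
  simp only [LinearMap.neg_apply, hYwz] at hw_left
  rw [hXq, hYq] at hz_right
  rw [hYq] at hqz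
  by_contra! hlt
  nlinarith

variable [Fintype ι]

theorem EdgeLengthLE.abs_le_of_edge_eq [Finite κ] (hC : C.EdgeLengthLE N) (h : C.Adj p i q k)
    (hj : j ≠ i) (hmk : m ≠ k) (hm : C.edge q m = C.edge p j + a • C.edge p i) :
    |a| ≤ 2 * Fintype.card ι + N :=
  abs_le.2 ⟨by linarith [hC.neg_le_of_edge_eq h hj hm], hC.le_of_edge_eq h hj hmk hm⟩

theorem EdgeLengthLE.abs_edge_le [Finite κ] (hC : C.EdgeLengthLE N) (h : C.Adj p i q k)
    (φ : Module.Dual ℤ M) {A : ℤ} (hA : ∀ j, |φ (C.edge p j)| ≤ A) (j : κ) :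
    |φ (C.edge q j)| ≤ (2 * Fintype.card ι + N + 1) * A := by
  have hA0 : 0 ≤ A := (abs_nonneg _).trans (hA i)
  rcases eq_or_ne j k with rfl | hj
  · rw [h.2, map_neg, abs_neg]
    nlinarith [hA i]
  · obtain ⟨m, hm, a, ha⟩ := h.symm.exists_edge_eq hj
    have hqj : C.edge q j = C.edge p m + a • C.edge p i := by rw [ha, h.2]; module
    calc |φ (C.edge q j)| = |φ (C.edge p m) + a * φ (C.edge p i)| := by simp [hqj]
      _ ≤ |φ (C.edge p m)| + |a| * |φ (C.edge p i)| := by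
        rw [← abs_mul]; exact abs_add_le _ _
      _ ≤ A + (2 * Fintype.card ι + N) * A := by
        gcongr
        exacts [hA m, hC.abs_le_of_edge_eq h hm hj hqj, hA i]
      _ = (2 * Fintype.card ι + N + 1) * A := by ring

/-- The path of the simplex method from `p` to `w` has at most one step per vertex. -/
theorem EdgeLengthLE.abs_vertex_sub_le [Fintype κ] (hC : C.EdgeLengthLE N) (φ : Module.Dual ℤ M)
    (w : ι) {p : ι} {A : ℤ} (hA0 : 0 ≤ A) (hA : ∀ j, |φ (C.edge p j)| ≤ A) :
    |φ (C.vertex w - C.vertex p)| ≤ countAbove (C.height w ∘ C.vertex) p *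
      (N * ((2 * Fintype.card ι + N + 1) ^ countAbove (C.height w ∘ C.vertex) p * A)) := by
  rcases eq_or_ne p w with rfl | hpw
  · rw [sub_self, map_zero, abs_zero]
    positivity
  obtain ⟨i, hi⟩ := exists_height_edge_pos (C := C) hpw
  obtain ⟨q, k, hadj⟩ := C.exists_adj p i
  obtain ⟨l, hl, hq⟩ := hadj.1
  have hlt : C.height w (C.vertex p) < C.height w (C.vertex q) := by
    rw [hq, map_add, map_smul, smul_eq_mul]
    linarith [mul_pos hl hi]
  have hcount := countAbove_lt_countAbove (C.height w ∘ C.vertex) hlt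
  set K : ℤ := 2 * Fintype.card ι + N + 1
  have hK1 : 1 ≤ K := by omega
  have ih := hC.abs_vertex_sub_le φ w (by positivity) (hC.abs_edge_le hadj φ hA)
  set n := countAbove (C.height w ∘ C.vertex) p
  set n' := countAbove (C.height w ∘ C.vertex) q
  calc |φ (C.vertex w - C.vertex p)| = |φ (C.vertex w - C.vertex q) + l * φ (C.edge p i)| := by
        congr 1
        simp only [hq, map_sub, map_add, map_smul, smul_eq_mul]
        ring
    _ ≤ |φ (C.vertex w - C.vertex q)| + l * |φ (C.edge p i)| := by
      rw [← abs_of_pos hl, ← abs_mul, abs_of_pos hl]; exact abs_add_le _ _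
    _ ≤ n' * (N * (K ^ n' * (K * A))) + N * A := by
      gcongr
      exacts [hC hq, hA i]
    _ ≤ n' * (N * (K ^ n * A)) + 1 * (N * (K ^ n * A)) := by
      rw [← mul_assoc (K ^ n'), ← pow_succ, one_mul]
      gcongr
      exacts [hcount, le_mul_of_one_le_left hA0 (one_le_pow₀ hK1)]
    _ = (n' + 1 : ℕ) * (N * (K ^ n * A)) := by push_cast; ring
    _ ≤ n * (N * (K ^ n * A)) := by
      gcongr
      exact hcount
termination_by countAbove (C.height w ∘ C.vertex) p
decreasing_by exact countAbove_lt_countAbove (C.height w ∘ C.vertex) hlt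

theorem EdgeLengthLE.abs_repr_le [Finite κ] (hC : C.EdgeLengthLE N) (p q : ι) (i : κ) :
    |(C.edge p).repr (C.vertex q - C.vertex p) i| ≤
      Fintype.card ι * (N * (2 * Fintype.card ι + N + 1) ^ Fintype.card ι) := by
  cases nonempty_fintype κ
  have hA : ∀ j, |(C.edge p).coord i (C.edge p j)| ≤ 1 := by
    intro j
    rcases eq_or_ne i j with rfl | hij
    · simp
    · simp [Finsupp.single_eq_of_ne hij]
  have hcount := countAbove_le_card (C.height q ∘ C.vertex) p
  refine (hC.abs_vertex_sub_le ((C.edge p).coord i) q zero_le_one hA).trans ?_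
  rw [mul_one]
  gcongr
  omega

end SmoothConfig

section ConvexHull

variable {E : Type*} [AddCommGroup E] [Module ℝ E] [TopologicalSpace E] [IsTopologicalAddGroup E]
  [ContinuousSMul ℝ E] [T2Space E] [LocallyConvexSpace ℝ E] {S : Set E}

theorem convexHull_extremePoints_convexHull (hS : S.Finite) :
    convexHull ℝ ((convexHull ℝ S).extremePoints ℝ) = convexHull ℝ S := by
  have hfin : ((convexHull ℝ S).extremePoints ℝ).Finite :=
    hS.subset extremePoints_convexHull_subset
  rw [← (hfin.isClosed_convexHull ℝ).closure_eq]
  exact closure_convexHull_extremePoints (hS.isCompact_convexHull ℝ) (convex_convexHull ℝ S)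

theorem extremePoints_convexHull_subset_exposedPoints (hS : S.Finite) :
    (convexHull ℝ S).extremePoints ℝ ⊆ (convexHull ℝ S).exposedPoints ℝ := by
  intro p hp
  have hpS : p ∈ S := extremePoints_convexHull_subset hp
  have hp_notMem : p ∉ convexHull ℝ (S \ {p}) := fun hmem =>
    (extremePoints_convexHull_subset (inter_extremePoints_subset_extremePoints_of_subset
      (convexHull_mono Set.sdiff_subset) ⟨hmem, hp⟩)).2 rfl
  obtain ⟨g, u, hlt, hu⟩ := geometric_hahn_banach_closed_point (convex_convexHull ℝ _)
    (hS.sdiff.isClosed_convexHull ℝ) hp_notMem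
  have hstrict : ∀ y ∈ convexHull ℝ S, y = p ∨ g y < g p := by
    intro y hy
    rcases (S \ {p}).eq_empty_or_nonempty with hempty | hne
    · rw [← Set.insert_sdiff_self_of_mem hpS, hempty] at hy
      simpa using Or.inl hy
    rw [← Set.insert_sdiff_self_of_mem hpS, convexHull_insert hne, convexJoin_singleton_left] at hy
    obtain ⟨z, hz, a, c, -, hc, hac, rfl⟩ := Set.mem_iUnion₂.1 hy
    rcases hc.eq_or_lt with rfl | hc
    · left
      obtain rfl : a = 1 := by simpa using hac
      simp
    · right
      have hgz : g z < g p := (hlt z hz).trans hu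
      rw [map_add, map_smul, map_smul, smul_eq_mul, smul_eq_mul, eq_sub_of_add_eq hac]
      nlinarith
  refine ⟨hp.1, g, fun y hy => ?_⟩
  rcases hstrict y hy with rfl | hlt
  · exact ⟨le_rfl, fun _ => rfl⟩
  · exact ⟨hlt.le, fun hle => absurd hlt hle.not_gt⟩

end ConvexHull

theorem exists_basis_coord_eq {κ R V : Type*} [Finite κ] [CommRing R] [AddCommGroup V] [Module R V]
    [Module.IsReflexive R V] (β : Module.Basis κ R (Module.Dual R V)) :
    ∃ b : Module.Basis κ R V, ∀ i, b.coord i = β i := by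
  classical
  let b := β.dualBasis.map (Module.evalEquiv R V).symm
  refine ⟨b, fun i => b.ext fun j => ?_⟩
  have heval := LinearMap.congr_fun
    ((Module.evalEquiv R V).apply_symm_apply (β.dualBasis j)) (β i)
  rw [Module.evalEquiv_apply, Module.Dual.eval_apply, Module.Basis.dualBasis_apply_self] at heval
  rw [Module.Basis.coord_apply, Module.Basis.repr_self, Module.Basis.map_apply, heval,
    Finsupp.single_apply]
  simp only [eq_comm]

theorem sum_erase_coord_apply_self {κ R V : Type*} [Fintype κ] [DecidableEq κ] [CommRing R]
    [AddCommGroup V] [Module R V] (b : Module.Basis κ R V) (i : κ) :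
    (∑ j ∈ Finset.univ.erase i, b.coord j) (b i) = 0 := by
  rw [LinearMap.sum_apply]
  exact Finset.sum_eq_zero fun j hj => by simp [Finsupp.single_eq_of_ne (Finset.ne_of_mem_erase hj)]

section Dual

variable {𝕜 : Type*} [Field 𝕜] [LinearOrder 𝕜] [IsStrictOrderedRing 𝕜]

theorem exists_forall_le_mul {α : Type*} {S : Set α} (hS : S.Finite) {f h : α → 𝕜}
    (hh : ∀ s ∈ S, 0 ≤ h s) (hf : ∀ s ∈ S, h s = 0 → f s ≤ 0) :
    ∃ K : 𝕜, ∀ s ∈ S, f s ≤ K * h s := by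
  have hlarge : ∀ s ∈ S, ∀ᶠ K : 𝕜 in Filter.atTop, f s ≤ K * h s := fun s hs => by
    rcases (hh s hs).eq_or_lt with hzero | hpos
    · exact .of_forall fun K => by rw [← hzero, mul_zero]; exact hf s hs hzero.symm
    · filter_upwards [Filter.eventually_ge_atTop (f s / h s)] with K hK
      exact (div_le_iff₀ hpos).1 hK
  exact ((Filter.eventually_all_finite hS).2 hlarge).exists

variable {κ V : Type*} [AddCommGroup V] [Module 𝕜 V]

theorem span_dual_eq_top {T : Set V} (hT : T.Finite) {γ : Module.Dual 𝕜 V}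
    (hγ : ∀ v ∈ T, v ≠ 0 → 0 < γ v) :
    Submodule.span 𝕜 (PointedCone.dual (Module.Dual.eval 𝕜 V) T : Set (Module.Dual 𝕜 V)) = ⊤ := by
  have hγ_nonneg : ∀ v ∈ T, 0 ≤ γ v := fun v hv => by
    rcases eq_or_ne v 0 with rfl | h0
    · simp
    · exact (hγ v hv h0).le
  rw [eq_top_iff]
  rintro φ -
  obtain ⟨K, hK⟩ := exists_forall_le_mul (f := fun v => -φ v) hT hγ_nonneg fun v hv hzero => by
    have hv0 : v = 0 := by_contra fun h0 => (hγ v hv h0).ne' hzero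
    simp [hv0]
  have hγ_mem : γ ∈ PointedCone.dual (Module.Dual.eval 𝕜 V) T := fun v hv => hγ_nonneg v hv
  have hφ_mem : φ + K • γ ∈ PointedCone.dual (Module.Dual.eval 𝕜 V) T := fun v hv => by
    have := hK v hv
    simp only [Module.Dual.eval_apply, LinearMap.add_apply, LinearMap.smul_apply, smul_eq_mul]
    linarith
  rw [← add_sub_cancel_right φ (K • γ)]
  exact Submodule.sub_mem _ (Submodule.subset_span hφ_mem)
    (Submodule.smul_mem _ K (Submodule.subset_span hγ_mem))

theorem mem_hull_range_coord [Finite κ] (b : Module.Basis κ 𝕜 V) {φ : Module.Dual 𝕜 V} :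
    φ ∈ PointedCone.hull 𝕜 (Set.range b.coord) ↔ ∀ i, 0 ≤ φ (b i) := by
  classical
  cases nonempty_fintype κ
  refine ⟨fun hφ i => ?_, fun hφ => ?_⟩
  · induction hφ using Submodule.span_induction with
    | mem ψ hψ =>
      obtain ⟨j, rfl⟩ := hψ
      rw [Module.Basis.coord_apply, Module.Basis.repr_self]
      exact Finsupp.single_nonneg.2 zero_le_one j
    | zero => simp
    | add ψ χ _ _ hψ hχ => exact add_nonneg hψ hχ
    | smul c ψ _ hψ => exact mul_nonneg c.2 hψ
  · have hsum : φ = ∑ i, (⟨φ (b i), hφ i⟩ : {c : 𝕜 // 0 ≤ c}) • b.coord i := by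
      refine b.ext fun j => ?_
      simp [Nonneg.mk_smul]
    rw [hsum]
    exact Submodule.sum_mem _ fun i _ =>
      Submodule.smul_mem _ _ (Submodule.subset_span (Set.mem_range_self i))

variable {b : Module.Basis κ 𝕜 V}

theorem eq_smul_of_sum_erase_eq_zero [Fintype κ] [DecidableEq κ] {v : V}
    (hv : ∀ j, 0 ≤ b.repr v j) {i : κ}
    (hsum : ∑ j ∈ Finset.univ.erase i, b.repr v j = 0) : v = b.repr v i • b i := by
  refine b.ext_elem fun j => ?_
  rcases eq_or_ne j i with rfl | hj
  · simp
  · simp [(Finset.sum_eq_zero_iff_of_nonneg fun j _ => hv j).1 hsum j (by simp [hj]),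
      Finsupp.single_eq_of_ne hj]

theorem exists_pos_smul_mem [Finite κ] {T : Set V} (hT : T.Finite)
    (hTb : ∀ v ∈ T, ∀ i, 0 ≤ b.repr v i) {i : κ}
    (hi : ∀ φ : Module.Dual 𝕜 V, (∀ v ∈ T, 0 ≤ φ v) → 0 ≤ φ (b i)) :
    ∃ t : 𝕜, 0 < t ∧ t • b i ∈ T := by
  classical
  cases nonempty_fintype κ
  by_contra! hno
  obtain ⟨K, hK⟩ := exists_forall_le_mul (f := fun v => b.repr v i)
    (h := fun v => ∑ j ∈ Finset.univ.erase i, b.repr v j) hT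
    (fun v hv => Finset.sum_nonneg fun j _ => hTb v hv j) fun v hv hsum => by
      by_contra! hpos
      exact hno _ hpos (eq_smul_of_sum_erase_eq_zero (hTb v hv) hsum ▸ hv)
  have hle := hi (K • ∑ j ∈ Finset.univ.erase i, b.coord j - b.coord i) fun v hv => by
    simpa using hK v hv
  rw [LinearMap.sub_apply, LinearMap.smul_apply, sum_erase_coord_apply_self] at hle
  norm_num at hle

end Dual

theorem IsUnimodularCone.exists_basis {W : Type*} [AddCommGroup W] [Module ℝ W] {L : Set W}
    {σ : PointedCone ℝ W} (h : IsUnimodularCone L σ)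
    (hσ : Submodule.span ℝ (σ : Set W) = ⊤) :
    ∃ β : Module.Basis (Fin (Module.finrank ℝ W)) ℝ W,
      (Submodule.span ℤ (Set.range β) : Set W) = L ∧ σ = PointedCone.hull ℝ (Set.range β) := by
  obtain ⟨B, hli, hint, hgen⟩ := h
  have hspan : ⊤ ≤ Submodule.span ℝ (Set.range ((↑) : B → W)) := by
    rw [← hσ, Submodule.span_le, hgen, Subtype.range_coe]
    exact PointedCone.hull_le_span (R := ℝ) _
  let β := Module.Basis.mk hli hspan
  have hcard : Fintype.card B = Module.finrank ℝ W := (Module.finrank_eq_card_basis β).symm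
  have hrange : Set.range (β.reindex (Fintype.equivFinOfCardEq hcard)) = B := by
    rw [Module.Basis.range_reindex, Module.Basis.coe_mk]
    exact Subtype.range_coe
  rw [hσ, Submodule.top_coe, Set.inter_univ] at hint
  exact ⟨β.reindex (Fintype.equivFinOfCardEq hcard), by rw [hrange, hint], by rw [hrange, hgen]⟩

theorem mem_span_int_iff_forall_dual {κ V : Type*} [AddCommGroup V] [Module ℝ V]
    (b : Module.Basis κ ℝ V) {v : V} :
    v ∈ Submodule.span ℤ (Set.range b) ↔
      ∀ φ ∈ Submodule.span ℤ (Set.range b.coord), ∃ k : ℤ, φ v = k := by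
  rw [Module.Basis.mem_span_iff_repr_mem]
  refine ⟨fun hv φ hφ => ?_, fun hv i => ?_⟩
  · induction hφ using Submodule.span_induction with
    | mem φ hφ =>
      obtain ⟨i, rfl⟩ := hφ
      obtain ⟨k, hk⟩ := hv i
      exact ⟨k, hk.symm⟩
    | zero => exact ⟨0, by simp⟩
    | add φ ψ _ _ hφ hψ =>
      obtain ⟨k, hk⟩ := hφ
      obtain ⟨l, hl⟩ := hψ
      exact ⟨k + l, by simp [hk, hl]⟩
    | smul a φ _ hφ =>
      obtain ⟨k, hk⟩ := hφ
      exact ⟨a * k, by simp [hk]⟩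
  · obtain ⟨k, hk⟩ := hv (b.coord i) (Submodule.subset_span (Set.mem_range_self i))
    exact ⟨k, hk.symm⟩

theorem intLattice_eq_span (n : ℕ) : IntLattice n =
    (Submodule.span ℤ (Set.range (Pi.basisFun ℝ (Fin n))) : Set (Fin n → ℝ)) := by
  ext x
  rw [SetLike.mem_coe, Module.Basis.mem_span_iff_repr_mem]
  simp [IntLattice, eq_comm]

namespace LatticePolytope

variable {n : ℕ} (P : LatticePolytope n)

theorem convex_carrier : Convex ℝ P.carrier := by
  obtain ⟨S, -, -, hS⟩ := P.exists_finset
  exact hS ▸ convex_convexHull ℝ _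

/-- The vertices of `P`, defined as its extreme points. -/
def vertices : Set (Fin n → ℝ) := P.carrier.extremePoints ℝ

theorem finite_vertices : P.vertices.Finite := by
  obtain ⟨S, -, -, hS⟩ := P.exists_finset
  rw [vertices, hS]
  exact S.finite_toSet.subset extremePoints_convexHull_subset

theorem vertices_subset_carrier : P.vertices ⊆ P.carrier := extremePoints_subset

theorem vertices_subset_intLattice : P.vertices ⊆ IntLattice n := by
  obtain ⟨S, -, hS_int, hS⟩ := P.exists_finset
  rw [vertices, hS]
  exact extremePoints_convexHull_subset.trans hS_int

theorem convexHull_vertices : convexHull ℝ P.vertices = P.carrier := by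
  obtain ⟨S, -, -, hS⟩ := P.exists_finset
  rw [vertices, hS]
  exact convexHull_extremePoints_convexHull S.finite_toSet

theorem vertices_nonempty : P.vertices.Nonempty := by
  rw [← convexHull_nonempty_iff (𝕜 := ℝ), convexHull_vertices]
  exact P.carrier_nonempty

theorem vertices_subset_exposedPoints : P.vertices ⊆ P.carrier.exposedPoints ℝ := by
  obtain ⟨S, -, -, hS⟩ := P.exists_finset
  rw [vertices, hS]
  exact extremePoints_convexHull_subset_exposedPoints S.finite_toSet

theorem vertices_injective : Function.Injective (vertices (n := n)) := by
  intro P Q h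
  have hcarrier : P.carrier = Q.carrier := by
    rw [← convexHull_vertices, h, convexHull_vertices]
  cases P
  cases Q
  congr

theorem dim_lt_ncard_vertices : P.dim < P.vertices.ncard := by
  have hcard : 0 < P.vertices.ncard := (Set.ncard_pos P.finite_vertices).2 P.vertices_nonempty
  have := P.finite_vertices.fintype
  have hdirection : P.direction = vectorSpan ℝ (Set.range ((↑) : P.vertices → Fin n → ℝ)) := by
    rw [direction, Subtype.range_coe, ← direction_affineSpan, ← convexHull_vertices,
      affineSpan_convexHull, direction_affineSpan]
  have hle := finrank_vectorSpan_range_le ℝ ((↑) : P.vertices → Fin n → ℝ)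
    (n := P.vertices.ncard - 1) (by rw [← Nat.card_eq_fintype_card, Nat.card_coe_set_eq]; omega)
  rw [dim, hdirection]
  omega

/-- The lattice `M = V ∩ ℤⁿ` in the direction `V` of `P`. -/
noncomputable def lattice : Submodule ℤ P.direction :=
  (Submodule.span ℤ (Set.range (Pi.basisFun ℝ (Fin n)))).comap
    (P.direction.subtype.restrictScalars ℤ)

variable {P} {p q : Fin n → ℝ}

theorem mem_lattice {v : P.direction} : v ∈ P.lattice ↔ (v : Fin n → ℝ) ∈ IntLattice n := by
  rw [intLattice_eq_span]
  rfl

theorem mem_lattice_iff_forall_dualLattice {v : P.direction} :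
    v ∈ P.lattice ↔ ∀ φ ∈ P.dualLattice, ∃ k : ℤ, φ v = k := by
  rw [mem_lattice]
  exact ⟨fun hv φ hφ => hφ v hv,
    fun hv i => hv (LinearMap.proj i ∘ₗ P.direction.subtype) fun w hw => hw i⟩

/-- The vector `q - p` between two points of `P`, as an element of the direction of `P`. -/
def disp (hp : p ∈ P.carrier) (hq : q ∈ P.carrier) : P.direction :=
  ⟨q - p, vsub_mem_vectorSpan ℝ hq hp⟩

@[simp]
theorem coe_disp (hp : p ∈ P.carrier) (hq : q ∈ P.carrier) :
    (disp hp hq : Fin n → ℝ) = q - p := rfl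

theorem disp_sub_disp {o : Fin n → ℝ} (ho : o ∈ P.carrier) (hp : p ∈ P.carrier)
    (hq : q ∈ P.carrier) : disp ho hq - disp ho hp = disp hp hq :=
  Subtype.ext (sub_sub_sub_cancel_right q p o)

theorem disp_mem_lattice (hp : p ∈ P.vertices) (hq : q ∈ P.vertices) :
    disp (P.vertices_subset_carrier hp) (P.vertices_subset_carrier hq) ∈ P.lattice := by
  have hp_int := P.vertices_subset_intLattice hp
  have hq_int := P.vertices_subset_intLattice hq
  rw [mem_lattice, coe_disp]
  rw [intLattice_eq_span] at *
  exact sub_mem hq_int hp_int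

/-- The vectors from `p` to the vertices of `P`, which generate the tangent cone of `P` at `p`. -/
def toVertices (P : LatticePolytope n) (p : Fin n → ℝ) : Set P.direction :=
  {v | p + (v : Fin n → ℝ) ∈ P.vertices}

theorem finite_toVertices (P : LatticePolytope n) (p : Fin n → ℝ) : (P.toVertices p).Finite :=
  P.finite_vertices.preimage
    ((add_right_injective p).comp Subtype.val_injective).injOn

theorem normalCone_singleton (hp : p ∈ P.carrier) :
    P.normalCone {p} = PointedCone.dual (Module.Dual.eval ℝ P.direction) (P.toVertices p) := by
  ext φ
  obtain ⟨l, rfl⟩ := φ.exists_extend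
  refine ⟨fun hφ v hv => hφ ⟨p, rfl, _, P.vertices_subset_carrier hv, by simp⟩, ?_⟩
  rintro hφ v ⟨x, hx, y, hy, hv⟩
  rw [Set.mem_singleton_iff.1 hx] at hv
  have hle : P.vertices ⊆ {z | l p ≤ l z} := fun z hz => by
    have := hφ (show disp hp (P.vertices_subset_carrier hz) ∈ P.toVertices p by
      simpa [toVertices] using hz)
    simpa using this
  rw [← convexHull_vertices] at hy
  simpa [hv] using convexHull_min hle (convex_halfSpace_ge l.isLinear _) hy

theorem isFace_singleton (hp : p ∈ P.vertices) : P.IsFace {p} :=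
  ⟨Set.singleton_nonempty p,
    mem_exposedPoints_iff_exposed_singleton.1 (P.vertices_subset_exposedPoints hp)⟩

theorem span_normalCone_singleton (hp : p ∈ P.vertices) :
    Submodule.span ℝ (P.normalCone {p} : Set (Module.Dual ℝ P.direction)) = ⊤ := by
  obtain ⟨hpP, g, hg⟩ := P.vertices_subset_exposedPoints hp
  rw [normalCone_singleton hpP]
  refine span_dual_eq_top (γ := -(g.toLinearMap ∘ₗ P.direction.subtype))
    (P.finite_toVertices p) fun v hv hv0 => ?_
  obtain ⟨hle, huniq⟩ := hg _ (P.vertices_subset_carrier hv)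
  have hlt : g (p + v) < g p := hle.lt_of_not_ge fun hge => hv0 (by simpa using huniq hge)
  simpa using hlt

theorem isFace_setOf_eq_zero (hp : p ∈ P.carrier) {φ : Module.Dual ℝ P.direction}
    (hφ : φ ∈ P.normalCone {p}) :
    P.IsFace {y | ∃ hy : y ∈ P.carrier, φ (disp hp hy) = 0} := by
  refine ⟨⟨p, hp, by rw [show disp hp hp = 0 from Subtype.ext (sub_self p), map_zero]⟩, fun _ => ?_⟩
  obtain ⟨l, rfl⟩ := φ.exists_extend
  have hle : ∀ y ∈ P.carrier, l p ≤ l y := fun y hy => by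
    simpa using hφ (show disp hp hy ∈ _ from ⟨p, rfl, y, hy, rfl⟩)
  refine ⟨LinearMap.toContinuousLinearMap (-l), Set.ext fun y => ⟨?_, ?_⟩⟩
  · rintro ⟨hy, hzero⟩
    have hly : l y = l p := by simpa [sub_eq_zero] using hzero
    exact ⟨hy, fun z hz => by simpa [hly] using hle z hz⟩
  · rintro ⟨hy, hmax⟩
    have hly : l y ≤ l p := by simpa using hmax p hp
    exact ⟨hy, by simpa [sub_eq_zero] using hly.antisymm (hle y hy)⟩

/-- `b` is the lattice basis formed by the primitive edge directions of `P` at the vertex `p`,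
encoded by the requirement that the normal cone at `p` is the cone generated by the basis dual
to `b`. -/
structure IsEdgeBasis (P : LatticePolytope n) (p : Fin n → ℝ)
    (b : Module.Basis (Fin P.dim) ℝ P.direction) : Prop where
  span_int_eq : Submodule.span ℤ (Set.range b) = P.lattice
  mem_normalCone : ∀ φ, φ ∈ P.normalCone {p} ↔ ∀ i, 0 ≤ φ (b i)

theorem IsSmooth.exists_isEdgeBasis (hP : P.IsSmooth) (hp : p ∈ P.vertices) :
    ∃ b, P.IsEdgeBasis p b := by
  obtain ⟨β, hβ_span, hβ_hull⟩ := (hP _ ⟨{p}, isFace_singleton hp, rfl⟩).exists_basis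
    (span_normalCone_singleton hp)
  let e : Fin (Module.finrank ℝ (Module.Dual ℝ P.direction)) ≃ Fin P.dim :=
    finCongr Subspace.dual_finrank_eq
  obtain ⟨b, hb⟩ := exists_basis_coord_eq (β.reindex e)
  have hrange : Set.range b.coord = Set.range β := by
    rw [show b.coord = _ from funext hb, Module.Basis.range_reindex]
  refine ⟨b, Submodule.ext fun v => ?_, fun φ => ?_⟩
  · rw [mem_span_int_iff_forall_dual, mem_lattice_iff_forall_dualLattice, hrange, ← hβ_span]
    rfl
  · rw [hβ_hull, ← hrange, mem_hull_range_coord]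

namespace IsEdgeBasis

variable {b : Module.Basis (Fin P.dim) ℝ P.direction}

theorem mem_lattice (hb : P.IsEdgeBasis p b) (i : Fin P.dim) : b i ∈ P.lattice := by
  rw [← hb.span_int_eq]
  exact Submodule.subset_span (Set.mem_range_self i)

theorem mem_lattice_iff (hb : P.IsEdgeBasis p b) {v : P.direction} :
    v ∈ P.lattice ↔ ∀ i, ∃ k : ℤ, b.repr v i = k := by
  rw [← hb.span_int_eq, Module.Basis.mem_span_iff_repr_mem]
  simp only [Set.mem_range, algebraMap_int_eq, eq_intCast, eq_comm]

theorem coord_mem_normalCone (hb : P.IsEdgeBasis p b) (i : Fin P.dim) :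
    b.coord i ∈ P.normalCone {p} :=
  (hb.mem_normalCone _).2 fun j => by
    rw [Module.Basis.coord_apply, Module.Basis.repr_self]
    exact Finsupp.single_nonneg.2 zero_le_one i

theorem repr_disp_nonneg (hb : P.IsEdgeBasis p b) (hp : p ∈ P.carrier) (hq : q ∈ P.carrier)
    (i : Fin P.dim) : 0 ≤ b.repr (disp hp hq) i :=
  hb.coord_mem_normalCone i ⟨p, rfl, q, hq, rfl⟩

theorem exists_vertex_on_ray (hb : P.IsEdgeBasis p b) (hp : p ∈ P.vertices) (i : Fin P.dim) :
    ∃ l : ℤ, 0 < l ∧ p + (l : ℝ) • (b i : Fin n → ℝ) ∈ P.vertices := by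
  have hpP := P.vertices_subset_carrier hp
  have hdual : P.normalCone {p} = _ := normalCone_singleton hpP
  obtain ⟨t, ht, hq⟩ := exists_pos_smul_mem (b := b) (i := i) (P.finite_toVertices p)
    (fun v hv j => (hdual ▸ hb.coord_mem_normalCone j :) hv)
    fun φ hφ => (hb.mem_normalCone φ).1 (hdual ▸ fun v hv => hφ v hv) i
  obtain ⟨l, hl⟩ := hb.mem_lattice_iff.1 (disp_mem_lattice hp hq) i
  have hdisp : disp hpP (P.vertices_subset_carrier hq) = t • b i := Subtype.ext (by simp)
  obtain rfl : t = l := by simpa [hdisp] using hl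
  exact ⟨l, by exact_mod_cast ht, hq⟩

theorem isEdge (hb : P.IsEdgeBasis p b) (hp : p ∈ P.vertices) (i : Fin P.dim) :
    P.IsEdge (P.carrier ∩ AffineSubspace.mk' p (ℝ ∙ (b i : Fin n → ℝ))) := by
  have hpP := P.vertices_subset_carrier hp
  have hφ : ∑ j ∈ Finset.univ.erase i, b.coord j ∈ P.normalCone {p} :=
    Submodule.sum_mem _ fun j _ => hb.coord_mem_normalCone j
  refine ⟨?_, ?_⟩
  · convert isFace_setOf_eq_zero hpP hφ using 1
    ext x
    simp only [Set.mem_inter_iff, SetLike.mem_coe, AffineSubspace.mem_mk',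
      Submodule.mem_span_singleton, vsub_eq_sub, Set.mem_ofPred_eq]
    constructor
    · rintro ⟨hx, t, ht⟩
      have hdisp : disp hpP hx = t • b i := Subtype.ext ht.symm
      exact ⟨hx, by rw [hdisp, map_smul, sum_erase_coord_apply_self, smul_zero]⟩
    · rintro ⟨hx, hzero⟩
      have hdisp := eq_smul_of_sum_erase_eq_zero (hb.repr_disp_nonneg hpP hx) (i := i)
        (by simpa using hzero)
      exact ⟨hx, _, (congrArg Subtype.val hdisp).symm⟩
  · have hspan : vectorSpan ℝ (P.carrier ∩ AffineSubspace.mk' p (ℝ ∙ (b i : Fin n → ℝ))) =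
        ℝ ∙ (b i : Fin n → ℝ) := by
      refine le_antisymm ((vectorSpan_mono ℝ Set.inter_subset_right).trans
        (AffineSubspace.direction_mk' p _).le) ?_
      obtain ⟨l, hl, hq⟩ := hb.exists_vertex_on_ray hp i
      have hmem := vsub_mem_vectorSpan ℝ
        (s := P.carrier ∩ AffineSubspace.mk' p (ℝ ∙ (b i : Fin n → ℝ)))
        ⟨P.vertices_subset_carrier hq, by simp [Submodule.mem_span_singleton_self,
          Submodule.smul_mem]⟩ ⟨hpP, AffineSubspace.self_mem_mk' p _⟩
      rw [vsub_eq_sub, add_sub_cancel_left] at hmem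
      rw [Submodule.span_singleton_le_iff_mem]
      exact (Submodule.smul_mem_iff _ (by exact_mod_cast hl.ne')).1 hmem
    rw [hspan, finrank_span_singleton (by simpa using b.ne_zero i)]

theorem mem_edgeLatticePoints (hb : P.IsEdgeBasis p b) (hp : p ∈ P.vertices) (i : Fin P.dim)
    (k : ℤ) (hk : p + (k : ℝ) • (b i : Fin n → ℝ) ∈ P.carrier) :
    p + (k : ℝ) • (b i : Fin n → ℝ) ∈ P.edgeLatticePoints := by
  refine ⟨?_, _, hb.isEdge hp i, hk, ?_⟩
  · have hp_int := P.vertices_subset_intLattice hp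
    have hbi := LatticePolytope.mem_lattice.1 (P.lattice.smul_mem k (hb.mem_lattice i))
    rw [intLattice_eq_span] at *
    rw [Int.cast_smul_eq_zsmul]
    exact add_mem hp_int hbi
  · simp [AffineSubspace.mem_mk', Submodule.smul_mem, Submodule.mem_span_singleton_self]

theorem le_of_mem_vertices (hb : P.IsEdgeBasis p b) (hp : p ∈ P.vertices) {N : ℕ}
    (hN : P.edgeLatticePoints.ncard = N + 1) {i : Fin P.dim} {t : ℤ}
    (ht : p + (t : ℝ) • (b i : Fin n → ℝ) ∈ P.vertices) : t ≤ N := by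
  have hinj : Function.Injective fun k : ℤ => p + (k : ℝ) • (b i : Fin n → ℝ) := fun k l hkl => by
    have hbi : (b i : Fin n → ℝ) ≠ 0 := by simpa using b.ne_zero i
    exact_mod_cast smul_left_injective ℝ hbi (add_left_cancel hkl)
  have hsub : (fun k : ℤ => p + (k : ℝ) • (b i : Fin n → ℝ)) '' Set.Icc 0 t ⊆
      P.edgeLatticePoints := by
    rintro _ ⟨k, ⟨hk, hkt⟩, rfl⟩
    refine hb.mem_edgeLatticePoints hp i k ?_
    rcases hk.eq_or_lt with rfl | hk
    · simpa using P.vertices_subset_carrier hp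
    have ht_pos : (0 : ℝ) < t := by exact_mod_cast hk.trans_le hkt
    have hkt' : (k : ℝ) ≤ t := by exact_mod_cast hkt
    have hmem := P.convex_carrier.add_smul_mem (P.vertices_subset_carrier hp)
      (P.vertices_subset_carrier ht) (t := (k : ℝ) / t)
      ⟨by positivity, (div_le_one ht_pos).2 hkt'⟩
    rwa [smul_smul, div_mul_cancel₀ _ ht_pos.ne'] at hmem
  have hcard := Set.ncard_le_ncard hsub (Set.finite_of_ncard_pos (by omega))
  rw [Set.ncard_image_of_injective _ hinj, hN, ← Finset.coe_Icc, Set.ncard_coe_finset,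
    Int.card_Icc] at hcard
  omega

/-- An edge basis as a `ℤ`-basis of the lattice of `P`. -/
noncomputable def intBasis (hb : P.IsEdgeBasis p b) : Module.Basis (Fin P.dim) ℤ P.lattice :=
  (b.restrictScalars ℤ).map (LinearEquiv.ofEq _ _ hb.span_int_eq)

theorem coe_intBasis (hb : P.IsEdgeBasis p b) (i : Fin P.dim) :
    (hb.intBasis i : P.direction) = b i := by
  simp [intBasis]

theorem intBasis_repr (hb : P.IsEdgeBasis p b) (v : P.lattice) (i : Fin P.dim) :
    (hb.intBasis.repr v i : ℝ) = b.repr v i :=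
  b.restrictScalars_repr_apply ℤ _ i

end IsEdgeBasis

theorem dim_pos (h : P.edgeLatticePoints.Nonempty) : 0 < P.dim := by
  obtain ⟨-, -, F, ⟨⟨-, hF⟩, hF_dim⟩, -⟩ := h
  rw [Nat.lt_iff_add_one_le, zero_add, ← hF_dim]
  exact Submodule.finrank_mono (vectorSpan_mono ℝ hF.subset)

theorem IsSmooth.ncard_vertices_le (hP : P.IsSmooth) {N : ℕ}
    (hN : P.edgeLatticePoints.ncard = N + 1) : P.vertices.ncard ≤ N + 1 := by
  have hpos := dim_pos (Set.nonempty_of_ncard_ne_zero (hN.trans_ne N.succ_ne_zero))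
  rw [← hN]
  refine Set.ncard_le_ncard (fun p hp => ?_) (Set.finite_of_ncard_pos (by omega))
  obtain ⟨b, hb⟩ := hP.exists_isEdgeBasis hp
  simpa using hb.mem_edgeLatticePoints hp ⟨0, hpos⟩ 0
    (by simpa using P.vertices_subset_carrier hp)

/-- The vertices of `P` with their edge bases, as a configuration in the lattice of `P` whose
origin is the vertex `o`. -/
noncomputable def smoothConfig {o : Fin n → ℝ} (ho : o ∈ P.vertices)
    {b : P.vertices → Module.Basis (Fin P.dim) ℝ P.direction}
    (hb : ∀ p : P.vertices, P.IsEdgeBasis p (b p)) :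
    SmoothConfig P.vertices (Fin P.dim) P.lattice where
  vertex q := ⟨_, disp_mem_lattice ho q.2⟩
  edge p := (hb p).intBasis
  vertex_injective p q hpq := by
    have hcoe : (p : Fin n → ℝ) - o = q - o :=
      congrArg (fun v : P.lattice => ((v : P.direction) : Fin n → ℝ)) hpq
    exact Subtype.ext (sub_left_injective hcoe)
  repr_nonneg p q i := by
    have hnonneg := (hb p).repr_disp_nonneg (P.vertices_subset_carrier p.2)
      (P.vertices_subset_carrier q.2) i
    rw [← disp_sub_disp (P.vertices_subset_carrier ho)] at hnonneg
    rw [← Int.cast_nonneg_iff (R := ℝ), IsEdgeBasis.intBasis_repr]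
    exact hnonneg
  exists_vertex_on_ray p i := by
    obtain ⟨l, hl, hq⟩ := (hb p).exists_vertex_on_ray p.2 i
    refine ⟨⟨_, hq⟩, l, hl, Subtype.ext (Subtype.ext ?_)⟩
    simp [IsEdgeBasis.coe_intBasis, add_sub_right_comm, Int.cast_smul_eq_zsmul, -zsmul_eq_mul]

theorem smoothConfig_edgeLengthLE {o : Fin n → ℝ} (ho : o ∈ P.vertices)
    {b : P.vertices → Module.Basis (Fin P.dim) ℝ P.direction}
    (hb : ∀ p : P.vertices, P.IsEdgeBasis p (b p)) {N : ℕ}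
    (hN : P.edgeLatticePoints.ncard = N + 1) : (smoothConfig ho hb).EdgeLengthLE N := by
  intro p q i t hq
  have hcoe : (q : Fin n → ℝ) - o = p - o + (t : ℝ) • (b p i : Fin n → ℝ) := by
    rw [Int.cast_smul_eq_zsmul, ← (hb p).coe_intBasis]
    exact congrArg (fun v : P.lattice => ((v : P.direction) : Fin n → ℝ)) hq
  refine (hb p).le_of_mem_vertices p.2 hN (i := i) (?_ : _ ∈ P.vertices)
  rw [sub_add_eq_add_sub] at hcoe
  rw [← sub_left_injective hcoe]
  exact q.2

/-- The bound on the coordinates of a smooth polytope with `N + 1` lattice points on its edges, with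
respect to the edge basis at any of its vertices. -/
def coordBound (N : ℕ) : ℕ := (N + 1) * (N * (2 * (N + 1) + N + 1) ^ (N + 1))

theorem IsSmooth.exists_isEdgeBasis_abs_repr_le (hP : P.IsSmooth) {N : ℕ}
    (hN : P.edgeLatticePoints.ncard = N + 1) {o : Fin n → ℝ} (ho : o ∈ P.vertices) :
    ∃ b, P.IsEdgeBasis o b ∧ ∀ q (hq : q ∈ P.vertices) (i : Fin P.dim),
      |b.repr (disp (P.vertices_subset_carrier ho) (P.vertices_subset_carrier hq)) i| ≤
        coordBound N := by
  choose b hb using fun p : P.vertices => hP.exists_isEdgeBasis p.2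
  refine ⟨b ⟨o, ho⟩, hb ⟨o, ho⟩, fun q hq i => ?_⟩
  have := P.finite_vertices.fintype
  have hcard : Fintype.card P.vertices ≤ N + 1 := by
    rw [← Nat.card_eq_fintype_card, Nat.card_coe_set_eq]
    exact hP.ncard_vertices_le hN
  have hle := (smoothConfig_edgeLengthLE ho hb hN).abs_repr_le ⟨o, ho⟩ ⟨q, hq⟩ i
  have hmono : Fintype.card P.vertices * (N * (2 * Fintype.card P.vertices + N + 1) ^
      Fintype.card P.vertices) ≤ coordBound N := by
    rw [coordBound]
    gcongr
    omega
  have hbound : |(((hb ⟨o, ho⟩).intBasis.repr ((smoothConfig ho hb).vertex ⟨q, hq⟩ -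
      (smoothConfig ho hb).vertex ⟨o, ho⟩) i : ℤ) : ℝ)| ≤ coordBound N := by
    exact_mod_cast hle.trans (by exact_mod_cast hmono)
  rw [IsEdgeBasis.intBasis_repr] at hbound
  rwa [← disp_sub_disp (P.vertices_subset_carrier ho) (P.vertices_subset_carrier ho)]

/-- The preimage of a lattice polytope under an injective affine map that respects the lattices and
whose range contains the polytope, encoded as the convex hull of the preimages of the vertices. -/
noncomputable def comap {d : ℕ} (P : LatticePolytope n) (φ : (Fin d → ℝ) →ᵃ[ℝ] (Fin n → ℝ))
    (hφ : Function.Injective φ) (hrange : P.vertices ⊆ Set.range φ)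
    (hlat : ∀ x, φ x ∈ IntLattice n ↔ x ∈ IntLattice d) : LatticePolytope d where
  carrier := convexHull ℝ (φ ⁻¹' P.vertices)
  exists_finset := by
    refine ⟨(P.finite_vertices.preimage hφ.injOn).toFinset, ?_, ?_, ?_⟩
    · obtain ⟨p, hp⟩ := P.vertices_nonempty
      obtain ⟨x, rfl⟩ := hrange hp
      exact ⟨x, by simpa using hp⟩
    · intro x hx
      exact (hlat x).1 (P.vertices_subset_intLattice (by simpa using hx))
    · rw [Set.Finite.coe_toFinset]

theorem integrallyEquivalent_comap {d : ℕ} (φ : (Fin d → ℝ) →ᵃ[ℝ] (Fin n → ℝ))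
    (hφ : Function.Injective φ) (hrange : P.vertices ⊆ Set.range φ)
    (hlat : ∀ x, φ x ∈ IntLattice n ↔ x ∈ IntLattice d) :
    IntegrallyEquivalent (P.comap φ hφ hrange hlat) P := by
  have himage : φ '' (P.comap φ hφ hrange hlat).carrier = P.carrier := by
    rw [comap, AffineMap.image_convexHull, Set.image_preimage_eq_of_subset hrange,
      convexHull_vertices]
  have hspan : (affineSpan ℝ (P.comap φ hφ hrange hlat).carrier).map φ =
      affineSpan ℝ P.carrier := by
    rw [AffineSubspace.map_span, himage]
  have : Nonempty ((affineSpan ℝ (P.comap φ hφ hrange hlat).carrier).map φ) := by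
    rw [hspan]
    infer_instance
  let e := ((affineSpan ℝ (P.comap φ hφ hrange hlat).carrier).equivMapOfInjective φ hφ).trans
    (AffineEquiv.ofEq _ _ hspan)
  have he : ∀ x, (e x : Fin n → ℝ) = φ x := fun x => rfl
  refine ⟨e, Set.ext (e.surjective.forall.2 fun x => ?_),
    Set.ext (e.surjective.forall.2 fun x => ?_)⟩
  · rw [e.injective.mem_set_image, Set.mem_ofPred_eq, Set.mem_ofPred_eq, he, hlat]
  · rw [e.injective.mem_set_image, Set.mem_ofPred_eq, Set.mem_ofPred_eq, he, ← himage,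
      hφ.mem_set_image]

theorem finite_setOf_carrier_subset {d : ℕ} {K : Set (Fin d → ℝ)} (hK : Bornology.IsBounded K) :
    {Q : LatticePolytope d | Q.carrier ⊆ K}.Finite := by
  have hfin : (K ∩ IntLattice d).Finite := by
    rw [intLattice_eq_span]
    exact ZSpan.setFinite_inter _ hK
  refine (hfin.finite_subsets.preimage vertices_injective.injOn).subset fun Q hQ => ?_
  exact Set.subset_inter (Q.vertices_subset_carrier.trans hQ) Q.vertices_subset_intLattice

theorem IsSmooth.exists_integrallyEquivalent_subset_closedBall (hP : P.IsSmooth) {N : ℕ}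
    (hN : P.edgeLatticePoints.ncard = N + 1) :
    ∃ Q : LatticePolytope P.dim, IntegrallyEquivalent Q P ∧
      Q.carrier ⊆ Metric.closedBall 0 (coordBound N) := by
  obtain ⟨o, ho⟩ := P.vertices_nonempty
  have ho_int := P.vertices_subset_intLattice ho
  obtain ⟨b, hb, hbound⟩ := hP.exists_isEdgeBasis_abs_repr_le hN ho
  let φ : (Fin P.dim → ℝ) →ᵃ[ℝ] (Fin n → ℝ) :=
    (P.direction.subtype ∘ₗ b.equivFun.symm.toLinearMap).toAffineMap + AffineMap.const ℝ _ o
  have hφ : ∀ x, φ x = (b.equivFun.symm x : Fin n → ℝ) + o := fun x => rfl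
  have hφ_disp : ∀ q (hq : q ∈ P.vertices),
      φ (b.equivFun (disp (P.vertices_subset_carrier ho) (P.vertices_subset_carrier hq))) = q :=
    fun q hq => by simp [hφ]
  have hφ_inj : Function.Injective φ := fun x y hxy =>
    b.equivFun.symm.injective (Subtype.ext (add_right_cancel hxy))
  have hlat : ∀ x, φ x ∈ IntLattice n ↔ x ∈ IntLattice P.dim := fun x => by
    have hiff : φ x ∈ IntLattice n ↔ b.equivFun.symm x ∈ P.lattice := by
      rw [hφ, mem_lattice]
      rw [intLattice_eq_span] at *
      exact Submodule.add_mem_iff_left _ ho_int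
    rw [hiff, hb.mem_lattice_iff]
    simp only [← Module.Basis.equivFun_apply, LinearEquiv.apply_symm_apply]
    rfl
  refine ⟨_, integrallyEquivalent_comap φ hφ_inj (fun q hq => ⟨_, hφ_disp q hq⟩) hlat,
    convexHull_min (fun x hx => ?_) (convex_closedBall 0 _)⟩
  rw [mem_closedBall_zero_iff, pi_norm_le_iff_of_nonneg (Nat.cast_nonneg _)]
  intro i
  rw [← hφ_inj (hφ_disp _ hx)]
  exact hbound _ hx i

end LatticePolytope

theorem mainTheorem4_general (N : ℕ) :
    {c : Quotient LatticePolytope.integralSetoid |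
      ∃ (n : ℕ) (P : LatticePolytope n),
        Quotient.mk LatticePolytope.integralSetoid ⟨n, P⟩ = c ∧
        P.IsSmooth ∧ P.edgeLatticePoints.ncard = N + 1}.Finite := by
  have hfinite : ∀ d : ℕ, ((fun Q : LatticePolytope d =>
      Quotient.mk LatticePolytope.integralSetoid ⟨d, Q⟩) ''
      {Q | Q.carrier ⊆ Metric.closedBall 0 (LatticePolytope.coordBound N)}).Finite := fun _ =>
    (LatticePolytope.finite_setOf_carrier_subset Metric.isBounded_closedBall).image _
  refine ((Set.finite_Iic N).biUnion fun d _ => hfinite d).subset ?_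
  rintro _ ⟨n, P, rfl, hP, hN⟩
  obtain ⟨Q, hQP, hQ⟩ := hP.exists_integrallyEquivalent_subset_closedBall hN
  have hdim : P.dim ≤ N :=
    Nat.lt_succ_iff.1 (P.dim_lt_ncard_vertices.trans_le (hP.ncard_vertices_le hN))
  exact Set.mem_biUnion hdim ⟨Q, hQ, Quotient.sound hQP⟩

theorem mainTheorem4 (d N : ℕ) :
    {c : Quotient LatticePolytope.integralSetoid |
      ∃ (n : ℕ) (P : LatticePolytope n),
        Quotient.mk LatticePolytope.integralSetoid ⟨n, P⟩ = c ∧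
        P.IsSmooth ∧ P.dim = d ∧ P.edgeLatticePoints.ncard = N + 1}.Finite :=
  (mainTheorem4_general N).subset fun _ ⟨n, P, hc, hP, _, hN⟩ => ⟨n, P, hc, hP, hN⟩
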